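/- A (one-round) $k$-server private information retrieval scheme for databases of $n$ bits consists of a user and $k$ databases that do not communicate with each other and all hold the same $x=(x_1,\dots,x_n)\in\{0,1\}^n$. On input $i\in\{1,\dots,n\}$ the user draws randomness and sends a bit string to each database; each database replies with a bit string that depends only on $x$ and on the string it received; and from $i$, the randomness and the replies the user outputs one bit. It is required that, for all $x$ and $i$, the output is $x_i$ with probability $1$, and that, for each $j\in\{1,\dots,k\}$, the distribution of the string sent to the $j$-th database does not depend on $i$. The length of each message depends only on the database concerned and on whether it is sent or received by it, and the communication complexity $C_k(n)$ is the total number of bits exchanged between the user and the $k$ databases. **Theorem.** For every integer $r>1$ there are an integer $k\le 3\cdot 2^{r-2}$ and a constant $c>0$ (both depending only on $r$) such that for every integer $n>1$ there is a $k$-server private information retrieval scheme for databases of $n$ bits, whose communication complexity satisfies, whenever $n\ge 3$, $$C_k(n)\le n^{\,c\,\left(\log\log n/\log n\right)^{(r-1)/r}},$$ that is, $C_k(n)=n^{O\left((\log\log n/\log n)^{(r-1)/r}\right)}$. Here $\log$ is the natural logarithm. -/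

import Mathlib

/-- A one-round protocol between a user and `k` non-communicating databases, each holding the
same string `x` of `n` bits. The user, who wants the bit with index `i`, draws a random `ρ`
from `coins`, sends the bit string `query i ρ j` to the `j`-th database, receives from it a bit
string that depends only on `x` and on the received query, and computes one bit from `i`, `ρ`
and all the answers. The message lengths depend only on the database, not on `i`, `x` or `ρ`. -/
structure PIRProtocol (k n : ℕ) where
  /-- the number of bits sent by the user to each database -/
  queryLen : Fin k → ℕ
  /-- the number of bits sent by each database to the user -/
  answerLen : Fin k → ℕ
  /-- the sample space of the user's randomness -/
  Rand : Type
  /-- the law of the user's randomness -/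
  coins : PMF Rand
  /-- the user's messages -/
  query : Fin n → Rand → (j : Fin k) → (Fin (queryLen j) → Bool)
  /-- the databases' messages -/
  answer : (j : Fin k) → (Fin n → Bool) → (Fin (queryLen j) → Bool) → (Fin (answerLen j) → Bool)
  /-- the user's output -/
  decode : Fin n → Rand → ((j : Fin k) → (Fin (answerLen j) → Bool)) → Bool

namespace PIRProtocol

variable {k n : ℕ} (P : PIRProtocol k n)

/-- What the user outputs on index `i` and randomness `ρ` when the data are `x`. -/
def output (x : Fin n → Bool) (i : Fin n) (ρ : P.Rand) : Bool :=
  P.decode i ρ (fun j => P.answer j x (P.query i ρ j))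

/-- For all data and all indices the output equals the requested bit with probability one. -/
def IsCorrect : Prop :=
  ∀ (x : Fin n → Bool) (i : Fin n), P.coins.map (P.output x i) = PMF.pure (x i)

/-- Perfect (information-theoretic) privacy: for each single database, the distribution of the
query that it receives is the same for all requested indices. -/
def IsPrivate : Prop :=
  ∀ (j : Fin k) (i i' : Fin n),
    P.coins.map (fun ρ => P.query i ρ j) = P.coins.map (fun ρ => P.query i' ρ j)

/-- The communication complexity: the total number of bits exchanged between the user and
the `k` databases. -/
def communication : ℕ := ∑ j, (P.queryLen j + P.answerLen j)

end PIRProtocol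

/-- A `k`-server private information retrieval scheme for databases of `n` bits. -/
structure PIRScheme (k n : ℕ) extends PIRProtocol k n where
  correct : toPIRProtocol.IsCorrect
  privacy : toPIRProtocol.IsPrivate

/-!
Attach to every bit a set of `W - 1` elements, where `W = ∏ pᵢ ^ eᵢ` for distinct primes `pᵢ`.
Two such sets are equal exactly when every `pᵢ ^ eᵢ` divides the size of their intersection plus
one, and by Lucas' theorem this divisibility is read off modulo `pᵢ` from an inner product of
vectors indexed by the subsets of size `pᵢ ^ eᵢ - 1` (Grolmusz). With roots of unity `γᵢ` of order
`pᵢ` in a finite field, the inner products become characters. The servers evaluate the sum of the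
characters of the bits equal to one along translates of a random point, one translate for each
monomial of a polynomial which is `1` at `(1, …, 1)` and vanishes at all other vertices of the box
`∏ {1, γᵢ}`; the matching combination of the answers isolates the wanted bit (Efremenko).

A product of linear factors has `2 ^ r` monomials, but for the primes `3` and `11` there is such a
polynomial with three monomials over `𝔽₆₇`, whence `3 * 2 ^ (r - 2)` servers.

Write `L = log n`. For the sets one takes graphs of functions into a set of `⌈L⌉` elements, so that
`W ≈ 2 L / log L` already gives `n` of them. Balancing the prime powers around `W ^ (1 / r)`, a
query has about `L ^ O(W ^ (1 / r))` bits, and `W ^ (1 / r) * log L` is of the order of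
`L * (log L / L) ^ ((r - 1) / r)`.
-/

open Filter Asymptotics
open scoped Finset Matrix

section Retrieval

theorem map_add_right_uniformOfFintype {V : Type*} [AddGroup V] [Fintype V] (s : V) :
    (PMF.uniformOfFintype V).map (· + s) = PMF.uniformOfFintype V := by
  classical
  ext v
  have hmem (w : V) : v = w + s ↔ w = v - s := by rw [eq_sub_iff_add_eq, eq_comm]
  simp [PMF.map_apply, hmem]

/-- The algebraic data behind a retrieval scheme: one additive character of `V` for each of the
`n` database bits, and for each of the `k` servers a coefficient and a list of shifts, such that
the combination of the values at the shifts for `b` isolates the character with index `b`. -/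
structure CharacterDecoder (V F : Type*) [AddMonoid V] [CommSemiring F] (k n : ℕ) where
  /-- the character attached to a database bit -/
  char : Fin n → AddChar V F
  /-- the weight of the answer of each server -/
  coeff : Fin k → F
  /-- the translation applied to the query to each server when a given bit is wanted -/
  shift : Fin k → Fin n → V
  sum_coeff_mul_char_shift : ∀ a b, ∑ j, coeff j * char a (shift j b) = if a = b then 1 else 0

namespace CharacterDecoder

variable {F : Type*} [CommSemiring F] {k n : ℕ}

section AddMonoid

variable {V : Type*} [AddMonoid V] (D : CharacterDecoder V F k n)

/-- The codeword of the database `x`, a function on `V`; the servers answer with its values. -/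
def encode (x : Fin n → Bool) (v : V) : F := ∑ a, if x a then D.char a v else 0

theorem sum_coeff_mul_encode (x : Fin n → Bool) (v : V) (b : Fin n) :
    ∑ j, D.coeff j * D.encode x (v + D.shift j b) = if x b then D.char b v else 0 := by
  calc ∑ j, D.coeff j * D.encode x (v + D.shift j b)
      = ∑ a, (if x a then D.char a v else 0) * ∑ j, D.coeff j * D.char a (D.shift j b) := by
        simp_rw [encode, Finset.mul_sum, AddChar.map_add_eq_mul]
        rw [Finset.sum_comm]
        refine Finset.sum_congr rfl fun a _ => Finset.sum_congr rfl fun j _ => ?_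
        split_ifs <;> ring
    _ = if x b then D.char b v else 0 := by simp [D.sum_coeff_mul_char_shift]

end AddMonoid

theorem sum_coeff_mul_encode_ne_zero_iff {V : Type*} [AddGroup V] [Nontrivial F]
    (D : CharacterDecoder V F k n) (x : Fin n → Bool) (v : V) (b : Fin n) :
    ∑ j, D.coeff j * D.encode x (v + D.shift j b) ≠ 0 ↔ x b = true := by
  rw [sum_coeff_mul_encode, ite_ne_right_iff,
    and_iff_left ((D.char b).val_isUnit v).ne_zero]

variable {V : Type} [AddGroup V] [Fintype V] {Q A : ℕ} (D : CharacterDecoder V F k n)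
  (encV : V ↪ (Fin Q → Bool)) (encF : F ↪ (Fin A → Bool))

open Classical in
/-- The protocol that evaluates the codeword of the database at random translates of the shifts;
`encV` and `encF` write queries and answers as bit strings. -/
noncomputable def protocol : PIRProtocol k n where
  queryLen _ := Q
  answerLen _ := A
  Rand := V
  coins := PMF.uniformOfFintype V
  query b v j := encV (v + D.shift j b)
  answer _ x q := encF (D.encode x (Function.invFun encV q))
  decode _ _ ans := decide (∑ j, D.coeff j * Function.invFun encF (ans j) ≠ 0)

theorem protocol_isCorrect [Nontrivial F] : (D.protocol encV encF).IsCorrect := by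
  classical
  intro x b
  have hdecV (v : V) : Function.invFun encV (encV v) = v :=
    Function.leftInverse_invFun encV.injective v
  have hdecF (z : F) : Function.invFun encF (encF z) = z :=
    Function.leftInverse_invFun encF.injective z
  have houtput (v : V) : (D.protocol encV encF).output x b v = x b := by
    change decide (∑ j, D.coeff j * Function.invFun encF (encF (D.encode x
      (Function.invFun encV (encV (v + D.shift j b))))) ≠ 0) = x b
    simp only [hdecV, hdecF, D.sum_coeff_mul_encode_ne_zero_iff, Bool.decide_eq_true]
  exact (congrArg (PMF.map · _) (funext houtput)).trans (PMF.map_const _ _)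

theorem protocol_isPrivate : (D.protocol encV encF).IsPrivate := by
  intro j b b'
  have hquery (b : Fin n) :
      (PMF.uniformOfFintype V).map (fun v => encV (v + D.shift j b)) =
        (PMF.uniformOfFintype V).map encV := by
    conv_rhs => rw [← map_add_right_uniformOfFintype (D.shift j b), PMF.map_comp]
    rfl
  exact (hquery b).trans (hquery b').symm

end CharacterDecoder

theorem CharacterDecoder.exists_pirScheme {V : Type} {F : Type*} [AddGroup V] [Finite V]
    [CommSemiring F] [Finite F] [Nontrivial F] {k n Q A : ℕ} (D : CharacterDecoder V F k n)
    (hQ : Nat.card V ≤ 2 ^ Q) (hA : Nat.card F ≤ 2 ^ A) :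
    ∃ S : PIRScheme k n, S.communication = k * (Q + A) := by
  have := Fintype.ofFinite V
  have := Fintype.ofFinite F
  obtain ⟨encV⟩ : Nonempty (V ↪ (Fin Q → Bool)) :=
    Function.Embedding.nonempty_of_card_le (by simpa using hQ)
  obtain ⟨encF⟩ : Nonempty (F ↪ (Fin A → Bool)) :=
    Function.Embedding.nonempty_of_card_le (by simpa using hA)
  exact ⟨⟨D.protocol encV encF, D.protocol_isCorrect encV encF, D.protocol_isPrivate encV encF⟩,
    by simp [PIRProtocol.communication, protocol]⟩

end Retrieval

section DecodingPolynomial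

/-- A decoding polynomial for `γ` separates the point `1` from the other vertices of the box
`∏ i, {1, γ i}`. The number of its monomials will be the number of servers. -/
structure IsDecodingPolynomial {ι R : Type*} [CommSemiring R] (γ : ι → R)
    (P : MvPolynomial ι R) : Prop where
  eval_one : P.eval 1 = 1
  eval_eq_zero : ∀ x : ι → R, (∀ i, x i = 1 ∨ x i = γ i) → x ≠ 1 → P.eval x = 0

variable {ι κ R : Type*}

theorem IsDecodingPolynomial.map [CommSemiring R] {S : Type*} [CommSemiring S] (f : R →+* S)
    {γ : ι → R} {P : MvPolynomial ι R} (hP : IsDecodingPolynomial γ P) :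
    IsDecodingPolynomial (f ∘ γ) (P.map f) where
  eval_one := by
    have hone : (1 : ι → S) = f ∘ (1 : ι → R) := by ext; simp
    rw [hone, ← MvPolynomial.map_eval, hP.eval_one, map_one]
  eval_eq_zero x hx hx1 := by
    have hlift (i : ι) : ∃ y, (y = 1 ∨ y = γ i) ∧ f y = x i := by
      rcases hx i with h | h
      · exact ⟨1, .inl rfl, by simp [h]⟩
      · exact ⟨γ i, .inr rfl, h.symm⟩
    choose y hy hfy using hlift
    obtain rfl : f ∘ y = x := funext hfy
    have hy1 : y ≠ 1 := by
      rintro rfl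
      exact hx1 (by ext; simp)
    rw [← MvPolynomial.map_eval, hP.eval_eq_zero y hy hy1, map_zero]

theorem IsDecodingPolynomial.rename_mul_rename [CommSemiring R] {γ : ι → R} {δ : κ → R}
    {P : MvPolynomial ι R} {Q : MvPolynomial κ R} (hP : IsDecodingPolynomial γ P)
    (hQ : IsDecodingPolynomial δ Q) :
    IsDecodingPolynomial (Sum.elim γ δ) (P.rename Sum.inl * Q.rename Sum.inr) where
  eval_one := by
    rw [map_mul, MvPolynomial.eval_rename, MvPolynomial.eval_rename, Pi.one_comp, Pi.one_comp,
      hP.eval_one, hQ.eval_one, one_mul]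
  eval_eq_zero x hx hx1 := by
    rw [map_mul, MvPolynomial.eval_rename, MvPolynomial.eval_rename]
    by_cases hl : x ∘ Sum.inl = 1
    · have hr : x ∘ Sum.inr ≠ 1 := fun hr =>
        hx1 (funext (Sum.rec (congrFun hl) (congrFun hr)))
      rw [hQ.eval_eq_zero (x ∘ Sum.inr) (fun i => hx (.inr i)) hr, mul_zero]
    · rw [hP.eval_eq_zero (x ∘ Sum.inl) (fun i => hx (.inl i)) hl, zero_mul]

theorem isDecodingPolynomial_prod [Fintype ι] [Field R] {γ : ι → R} (hγ : ∀ i, γ i ≠ 1) :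
    IsDecodingPolynomial γ
      (∏ i, MvPolynomial.C (1 - γ i)⁻¹ * (MvPolynomial.X i - MvPolynomial.C (γ i))) where
  eval_one := by
    simp [map_prod, inv_mul_cancel₀ (sub_ne_zero.2 (hγ _).symm)]
  eval_eq_zero x hx hx1 := by
    obtain ⟨i, hi⟩ := Function.ne_iff.1 hx1
    rw [map_prod]
    refine Finset.prod_eq_zero (Finset.mem_univ i) ?_
    simp [(hx i).resolve_left hi]

theorem card_support_monomial_le [CommSemiring R] (m : ι →₀ ℕ) (a : R) :
    #(MvPolynomial.monomial m a).support ≤ 1 :=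
  Finset.card_le_card MvPolynomial.support_monomial_subset

theorem card_support_add_le [CommSemiring R] (P Q : MvPolynomial ι R) :
    #(P + Q).support ≤ #P.support + #Q.support := by
  classical
  exact (Finset.card_le_card MvPolynomial.support_add).trans (Finset.card_union_le _ _)

theorem card_support_mul_le [CommSemiring R] (P Q : MvPolynomial ι R) :
    #(P * Q).support ≤ #P.support * #Q.support := by
  classical
  exact (Finset.card_le_card (MvPolynomial.support_mul P Q)).trans Finset.card_add_le

theorem card_support_prod_le [CommSemiring R] (s : Finset κ) (P : κ → MvPolynomial ι R) :
    #(∏ j ∈ s, P j).support ≤ ∏ j ∈ s, #(P j).support :=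
  Finset.le_prod_of_submultiplicative (fun Q => #Q.support) (card_support_monomial_le 0 1)
    card_support_mul_le s P

theorem card_support_rename_le [CommSemiring R] {f : ι → κ} (hf : Function.Injective f)
    (P : MvPolynomial ι R) : #(P.rename f).support ≤ #P.support := by
  classical
  rw [MvPolynomial.support_rename_of_injective hf]
  exact Finset.card_image_le

theorem card_support_C_mul_X_sub_C_le [CommRing R] (a b : R) (i : ι) :
    #(MvPolynomial.C a * (MvPolynomial.X i - MvPolynomial.C b)).support ≤ 2 := by
  rw [sub_eq_add_neg, ← MvPolynomial.C_neg]
  exact (card_support_mul_le _ _).trans <| Nat.mul_le_mul (card_support_monomial_le _ _) <|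
    (card_support_add_le _ _).trans <|
      Nat.add_le_add (card_support_monomial_le _ _) (card_support_monomial_le _ _)

end DecodingPolynomial

section MatchingFamily

/-- A matching family of vectors over a product of semirings, each factor having its own
coordinates: in every factor `u a` and `v b` have inner product `0` or `1`, and it is `0` in all of
them exactly when `a = b`. -/
structure IsMatchingFamily {α ι : Type*} {J R : ι → Type*} [∀ i, Fintype (J i)]
    [∀ i, Semiring (R i)] (u v : α → ∀ i, J i → R i) : Prop where
  dotProduct_eq_zero_or_one : ∀ a b i, u a i ⬝ᵥ v b i = 0 ∨ u a i ⬝ᵥ v b i = 1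
  forall_dotProduct_eq_zero_iff : ∀ a b, (∀ i, u a i ⬝ᵥ v b i = 0) ↔ a = b

section DotProductChar

variable {ι F : Type*} {J R : ι → Type*} [∀ i, Fintype (J i)]

theorem IsMatchingFamily.eval_decodingPolynomial [∀ i, Semiring (R i)] [CommSemiring F]
    {α : Type*} [DecidableEq α] {u v : α → ∀ i, J i → R i} (huv : IsMatchingFamily u v)
    {ψ : ∀ i, AddChar (R i) F} (hψ : ∀ i, ψ i 1 ≠ 1) {P : MvPolynomial ι F}
    (hP : IsDecodingPolynomial (fun i => ψ i 1) P) (a b : α) :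
    P.eval (fun i => ψ i (u a i ⬝ᵥ v b i)) = if a = b then 1 else 0 := by
  have hbox (i : ι) : ψ i (u a i ⬝ᵥ v b i) = 1 ∨ ψ i (u a i ⬝ᵥ v b i) = ψ i 1 := by
    rcases huv.dotProduct_eq_zero_or_one a b i with h | h <;> simp [h]
  split_ifs with hab
  · have hone : (fun i => ψ i (u a i ⬝ᵥ v b i)) = 1 := by
      ext i
      simp [(huv.forall_dotProduct_eq_zero_iff a b).2 hab i]
    rw [hone, hP.eval_one]
  · refine hP.eval_eq_zero _ hbox fun hone => hab ?_
    refine (huv.forall_dotProduct_eq_zero_iff a b).1 fun i => ?_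
    refine (huv.dotProduct_eq_zero_or_one a b i).resolve_right fun h => hψ i ?_
    rw [← h]
    exact congrFun hone i

section Character

variable [Fintype ι] [∀ i, Semiring (R i)] [CommMonoid F]

/-- The character `v ↦ ∏ i, ψ i (u i ⬝ᵥ v i)` of `∏ i, R i ^ J i`. -/
def dotProductChar (ψ : ∀ i, AddChar (R i) F) (u : ∀ i, J i → R i) :
    AddChar (∀ i, J i → R i) F where
  toFun v := ∏ i, ψ i (u i ⬝ᵥ v i)
  map_zero_eq_one' := by simp
  map_add_eq_mul' v w := by
    simp [dotProduct_add, AddChar.map_add_eq_mul, Finset.prod_mul_distrib]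

theorem dotProductChar_nsmul (ψ : ∀ i, AddChar (R i) F) (u v : ∀ i, J i → R i) (m : ι → ℕ) :
    dotProductChar ψ u (fun i => m i • v i) = ∏ i, ψ i (u i ⬝ᵥ v i) ^ m i := by
  refine Finset.prod_congr rfl fun i _ => ?_
  rw [dotProduct_smul, AddChar.map_nsmul_eq_pow]

end Character

/-- The server attached to a monomial `m` of the decoding polynomial receives the query shifted by
`m i • v b i`, which turns the inner products into the monomial evaluated at their characters. -/
noncomputable def IsMatchingFamily.characterDecoder [∀ i, Ring (R i)]
    [CommSemiring F] [Fintype ι] {n : ℕ} {u v : Fin n → ∀ i, J i → R i}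
    (huv : IsMatchingFamily u v) {ψ : ∀ i, AddChar (R i) F} (hψ : ∀ i, ψ i 1 ≠ 1)
    {P : MvPolynomial ι F} (hP : IsDecodingPolynomial (fun i => ψ i 1) P) :
    CharacterDecoder (∀ i, J i → R i) F #P.support n where
  char a := dotProductChar ψ (u a)
  coeff j := P.coeff (P.support.equivFin.symm j : ι →₀ ℕ)
  shift j b i := (P.support.equivFin.symm j : ι →₀ ℕ) i • v b i
  sum_coeff_mul_char_shift a b := by
    simp_rw [dotProductChar_nsmul]
    rw [← huv.eval_decodingPolynomial hψ hP, MvPolynomial.eval_eq', ← P.support.sum_coe_sort]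
    exact P.support.equivFin.symm.sum_comp fun m : P.support =>
      P.coeff m * ∏ i, ψ i (u a i ⬝ᵥ v b i) ^ (m : ι →₀ ℕ) i

end DotProductChar

theorem pow_succ_dvd_add_one_iff {p : ℕ} (hp : 0 < p) (e t : ℕ) :
    p ^ (e + 1) ∣ t + 1 ↔ t % p + 1 = p ∧ p ^ e ∣ t / p + 1 := by
  have hmod := Nat.mod_lt t hp
  have hdigits := Nat.div_add_mod t p
  constructor
  · intro h
    have hlast : t % p + 1 = p := by
      have hdvd : p ∣ p * (t / p) + (t % p + 1) := by
        rw [← add_assoc, hdigits]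
        exact (dvd_pow_self p e.succ_ne_zero).trans h
      exact le_antisymm hmod
        (Nat.le_of_dvd (Nat.succ_pos _) ((Nat.dvd_add_right (dvd_mul_right _ _)).1 hdvd))
    refine ⟨hlast, (Nat.mul_dvd_mul_iff_left hp).1 ?_⟩
    rwa [← pow_succ', mul_add_one, ← hlast, ← add_assoc, hlast, hdigits]
  · rintro ⟨hlast, h⟩
    have hfactor : t + 1 = p * (t / p + 1) := by rw [mul_add_one]; omega
    rw [hfactor, pow_succ']
    exact Nat.mul_dvd_mul_left p h

theorem cast_choose_prime_pow_sub_one (p : ℕ) [hp : Fact p.Prime] (e t : ℕ) :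
    (t.choose (p ^ e - 1) : ZMod p) = if p ^ e ∣ t + 1 then 1 else 0 := by
  induction e generalizing t with
  | zero => simp
  | succ e ih =>
    have hp0 : 0 < p := hp.out.pos
    have hdigits : p ^ (e + 1) - 1 = p * (p ^ e - 1) + (p - 1) := by
      have : p ≤ p * p ^ e := Nat.le_mul_of_pos_right _ (by positivity)
      rw [pow_succ', Nat.mul_sub, mul_one]
      omega
    have hmod : (p ^ (e + 1) - 1) % p = p - 1 := by
      rw [hdigits, Nat.mul_add_mod, Nat.mod_eq_of_lt (by omega)]
    have hdiv : (p ^ (e + 1) - 1) / p = p ^ e - 1 := by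
      rw [hdigits, Nat.mul_add_div hp0, Nat.div_eq_of_lt (by omega), add_zero]
    have hlucas := (ZMod.natCast_eq_natCast_iff _ _ p).2
      (Choose.choose_modEq_choose_mod_mul_choose_div_nat (p := p) (n := t) (k := p ^ (e + 1) - 1))
    rw [hlucas, hmod, hdiv, Nat.cast_mul, ih, if_congr (pow_succ_dvd_add_one_iff hp0 e t) rfl rfl]
    have hlt : t % p < p := Nat.mod_lt t hp0
    by_cases hlast : t % p + 1 = p
    · simp [(by omega : t % p = p - 1), Nat.sub_add_cancel hp0]
    · simp [hlast, Nat.choose_eq_zero_of_lt (by omega : t % p < p - 1)]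

theorem forall_prime_pow_dvd_card_inter_add_one_iff {α ι : Type*} [DecidableEq α] [Fintype ι]
    {p e : ι → ℕ} (hp : ∀ i, (p i).Prime) (hinj : Function.Injective p) {A B : Finset α}
    (hA : #A + 1 = ∏ i, p i ^ e i) (hB : #B + 1 = ∏ i, p i ^ e i) :
    (∀ i, p i ^ e i ∣ #(A ∩ B) + 1) ↔ A = B := by
  constructor
  · intro h
    have hdvd : ∏ i, p i ^ e i ∣ #(A ∩ B) + 1 :=
      Finset.prod_dvd_of_isRelPrime (fun i _ j _ hij => Nat.coprime_iff_isRelPrime.1 <|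
        .pow _ _ <| (Nat.coprime_primes (hp i) (hp j)).2 (hinj.ne hij)) fun i _ => h i
    have hle := Nat.le_of_dvd (Nat.succ_pos _) hdvd
    have hinterA : A ∩ B = A :=
      Finset.eq_of_subset_of_card_le Finset.inter_subset_left (by omega)
    have hinterB : A ∩ B = B :=
      Finset.eq_of_subset_of_card_le Finset.inter_subset_right (by omega)
    exact hinterA.symm.trans hinterB
  · rintro rfl i
    rw [Finset.inter_self, hA]
    exact Finset.dvd_prod_of_mem (fun i => p i ^ e i) (Finset.mem_univ i)

section SubsetVector

variable {α : Type*} [Fintype α] [DecidableEq α]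

/-- The coordinates of a set on the `d`-element sets: whether they are contained in it. -/
def subsetVector (R : Type*) [Zero R] [One R] (d : ℕ) (A : Finset α) :
    Finset.powersetCard d (Finset.univ : Finset α) → R :=
  fun C => if C.1 ⊆ A then 1 else 0

theorem subsetVector_dotProduct (R : Type*) [Semiring R] (d : ℕ) (A B : Finset α) :
    subsetVector R d A ⬝ᵥ subsetVector R d B = ((#(A ∩ B)).choose d : R) := by
  have hmul (C : Finset α) : ((if C ⊆ A then 1 else 0) * if C ⊆ B then 1 else 0 : R) =
      if C ⊆ A ∩ B then 1 else 0 := by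
    rw [ite_zero_mul_ite_zero, mul_one, if_congr Finset.subset_inter_iff.symm rfl rfl]
  have hfilter : (Finset.powersetCard d Finset.univ).filter (· ⊆ A ∩ B) =
      Finset.powersetCard d (A ∩ B) := by
    ext C
    rw [Finset.mem_filter, Finset.mem_powersetCard_univ, Finset.mem_powersetCard, and_comm]
  simp_rw [dotProduct, subsetVector, hmul]
  rw [Finset.sum_coe_sort _ fun C => if C ⊆ A ∩ B then (1 : R) else 0, Finset.sum_boole, hfilter,
    Finset.card_powersetCard]

/-- Grolmusz's construction. The inner product in the factor `i` is
`1 - (#(S a ∩ S b)).choose (p i ^ e i - 1)`, which by Lucas' theorem only depends on whether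
`p i ^ e i` divides `#(S a ∩ S b) + 1`. -/
theorem isMatchingFamily_subsetVector {ι κ : Type*} [Fintype ι] {p e : ι → ℕ}
    (hp : ∀ i, (p i).Prime) (hinj : Function.Injective p) {S : κ → Finset α}
    (hS : Function.Injective S) (hcard : ∀ a, #(S a) + 1 = ∏ i, p i ^ e i) :
    IsMatchingFamily
      (fun a i => Sum.elim (1 : Unit → ZMod (p i))
        (subsetVector (ZMod (p i)) (p i ^ e i - 1) (S a)))
      (fun b i => Sum.elim (1 : Unit → ZMod (p i))
        (-subsetVector (ZMod (p i)) (p i ^ e i - 1) (S b))) := by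
  have hdot (a b : κ) (i : ι) :
      Sum.elim (1 : Unit → ZMod (p i)) (subsetVector (ZMod (p i)) (p i ^ e i - 1) (S a)) ⬝ᵥ
        Sum.elim (1 : Unit → ZMod (p i)) (-subsetVector (ZMod (p i)) (p i ^ e i - 1) (S b)) =
      if p i ^ e i ∣ #(S a ∩ S b) + 1 then 0 else 1 := by
    have : Fact (p i).Prime := ⟨hp i⟩
    rw [sumElim_dotProduct_sumElim, dotProduct_neg, subsetVector_dotProduct,
      cast_choose_prime_pow_sub_one]
    split_ifs <;> simp
  refine ⟨fun a b i => ?_, fun a b => ?_⟩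
  · rw [hdot]
    exact ite_eq_or_eq _ _ _
  · have (i : ι) : Fact (p i).Prime := ⟨hp i⟩
    simp_rw [hdot, ite_eq_left_iff, one_ne_zero, imp_false, not_not]
    rw [forall_prime_pow_dvd_card_inter_add_one_iff hp hinj (hcard a) (hcard b), hS.eq_iff]

end SubsetVector

theorem exists_injective_finset_card_eq {n w b : ℕ} (h : n ≤ b ^ w) :
    ∃ S : Fin n → Finset (Fin w × Fin b), Function.Injective S ∧ ∀ a, #(S a) = w := by
  obtain ⟨g⟩ : Nonempty (Fin n ↪ (Fin w → Fin b)) :=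
    Function.Embedding.nonempty_of_card_le (by simpa using h)
  let graph (f : Fin w → Fin b) : Finset (Fin w × Fin b) :=
    Finset.univ.image fun j => (j, f j)
  have hmem (f : Fin w → Fin b) (j : Fin w) (y : Fin b) : (j, y) ∈ graph f ↔ f j = y := by
    simp [graph]
  refine ⟨fun a => graph (g a), fun a a' haa' => g.injective (funext fun j => ?_), fun a => ?_⟩
  · have hgraph : graph (g a) = graph (g a') := haa'
    exact ((hmem _ _ _).1 (hgraph ▸ (hmem (g a) j _).2 rfl)).symm
  · exact (Finset.card_image_of_injective _ fun _ _ h => congrArg Prod.fst h).trans (by simp)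

/-- The number of bits that suffice for a query built from subsets of an `N`-element set: one
residue modulo `p i` for each subset of `p i ^ e i - 1` elements, and one more. -/
def queryBits {ι : Type*} [Fintype ι] (p e : ι → ℕ) (N : ℕ) : ℕ :=
  ∑ i, p i * (N.choose (p i ^ e i - 1) + 1)

theorem card_query_le_two_pow_queryBits {ι α : Type*} [Fintype ι] [Fintype α]
    (p e : ι → ℕ) :
    Nat.card (∀ i, Unit ⊕ Finset.powersetCard (p i ^ e i - 1) (Finset.univ : Finset α) →
      ZMod (p i)) ≤ 2 ^ queryBits p e (Fintype.card α) := by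
  rw [queryBits, ← Finset.prod_pow_eq_pow_sum, Nat.card_pi]
  refine Finset.prod_le_prod' fun i _ => ?_
  rw [Nat.card_fun, Nat.card_zmod, Nat.card_sum, Nat.card_unique,
    Nat.card_eq_fintype_card (α := Finset.powersetCard _ _), Fintype.card_coe,
    Finset.card_powersetCard, Finset.card_univ, pow_mul, add_comm]
  exact Nat.pow_le_pow_left Nat.lt_two_pow_self.le _

theorem exists_pirScheme_of_le_pow {ι : Type} [Fintype ι] {F : Type*} [Field F] [Finite F]
    {p : ι → ℕ} (hp : ∀ i, (p i).Prime) (hinj : Function.Injective p) {γ : ι → F}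
    (hγ : ∀ i, IsPrimitiveRoot (γ i) (p i)) {P : MvPolynomial ι F} (hP : IsDecodingPolynomial γ P)
    (e : ι → ℕ) {n b : ℕ} (hn : n ≤ b ^ (∏ i, p i ^ e i - 1)) :
    ∃ S : PIRScheme #P.support n, S.communication =
      #P.support * (queryBits p e ((∏ i, p i ^ e i - 1) * b) + Nat.card F) := by
  classical
  have (i : ι) : NeZero (p i) := ⟨(hp i).ne_zero⟩
  obtain ⟨S, hS, hcard⟩ := exists_injective_finset_card_eq hn
  have hW : 0 < ∏ i, p i ^ e i := Finset.prod_pos fun i _ => pow_pos (hp i).pos _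
  let ψ (i : ι) : AddChar (ZMod (p i)) F := AddChar.zmodChar (p i) (hγ i).pow_eq_one
  have hψ (i : ι) : ψ i 1 = γ i := by
    simpa using AddChar.zmodChar_apply' (hγ i).pow_eq_one 1
  have hP' : IsDecodingPolynomial (fun i => ψ i 1) P := by simpa only [hψ] using hP
  have hψ1 (i : ι) : ψ i 1 ≠ 1 := hψ i ▸ (hγ i).ne_one (hp i).one_lt
  have hmatching := isMatchingFamily_subsetVector hp hinj hS fun a => by
    rw [hcard, Nat.sub_add_cancel hW]
  have hQ := card_query_le_two_pow_queryBits (α := Fin (∏ i, p i ^ e i - 1) × Fin b) p e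
  rw [Fintype.card_prod, Fintype.card_fin, Fintype.card_fin] at hQ
  exact (hmatching.characterDecoder hψ1 hP').exists_pirScheme hQ Nat.lt_two_pow_self.le

end MatchingFamily

section Parameters

theorem exists_pow_mem_Icc {K : Type*} [Field K] [LinearOrder K] [IsStrictOrderedRing K]
    [Archimedean K] {p y : K} (hp : 1 < p) (hy : 1 ≤ y) :
    ∃ e : ℕ, p ^ e ∈ Set.Icc y (p * y) := by
  obtain ⟨e, hle, hlt⟩ := exists_nat_pow_near hy hp
  refine ⟨e + 1, hlt.le, ?_⟩
  rw [pow_succ']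
  gcongr

theorem exists_prod_pow_mem_Icc {ι : Type*} [Fintype ι] [Nonempty ι] {p : ι → ℝ}
    (hp : ∀ i, 1 < p i) {X : ℝ} (hX : 1 ≤ X) :
    ∃ e : ι → ℕ, ∏ i, p i ^ e i ∈ Set.Icc X ((∏ i, p i) * X) ∧
      ∀ i, p i ^ e i ≤ p i * X ^ (Fintype.card ι : ℝ)⁻¹ := by
  have hy : 1 ≤ X ^ (Fintype.card ι : ℝ)⁻¹ := Real.one_le_rpow hX (by positivity)
  have hyX : ∏ _i : ι, X ^ (Fintype.card ι : ℝ)⁻¹ = X := by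
    rw [Finset.prod_const, Finset.card_univ,
      Real.rpow_inv_natCast_pow (by positivity) Fintype.card_ne_zero]
  choose e he using fun i => exists_pow_mem_Icc (hp i) hy
  have hp0 (i : ι) : 0 ≤ p i := zero_le_one.trans (hp i).le
  refine ⟨e, ⟨?_, ?_⟩, fun i => (he i).2⟩
  · rw [← hyX]
    exact Finset.prod_le_prod (fun _ _ => by positivity) fun i _ => (he i).1
  · conv_rhs => rw [← hyX, ← Finset.prod_mul_distrib]
    exact Finset.prod_le_prod (fun i _ => pow_nonneg (hp0 i) _) fun i _ => (he i).2

theorem one_lt_log_of_log_log_pos {n : ℕ} (hn : 0 < Real.log (Real.log n)) : 1 < Real.log n :=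
  (Real.log_pos_iff (Real.log_natCast_nonneg n)).1 hn

theorem le_ceil_log_pow {n W : ℕ} (hn : 0 < Real.log (Real.log n))
    (hW : 2 * Real.log n / Real.log (Real.log n) ≤ W) : n ≤ ⌈Real.log n⌉₊ ^ (W - 1) := by
  set L := Real.log n
  have hL1 : 1 < L := one_lt_log_of_log_log_pos hn
  have hl : Real.log L ≤ L := Real.log_le_self (by positivity)
  have hW' : 2 * L ≤ W * Real.log L := (div_le_iff₀ hn).1 hW
  have hW1 : 1 ≤ W := by
    by_contra! h
    obtain rfl : W = 0 := by omega
    norm_num at hW'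
    linarith
  have hreal : (n : ℝ) ≤ L ^ (W - 1) := by
    calc (n : ℝ) ≤ Real.exp L := Real.le_exp_log _
      _ ≤ Real.exp (((W - 1 : ℕ) : ℝ) * Real.log L) := by
        rw [Real.exp_le_exp, Nat.cast_pred hW1]
        linarith
      _ = L ^ (W - 1) := by rw [Real.exp_nat_mul, Real.exp_log (by positivity)]
  have hceil : (n : ℝ) ≤ (⌈L⌉₊ : ℝ) ^ (W - 1) :=
    hreal.trans (pow_le_pow_left₀ (by positivity) (Nat.le_ceil L) _)
  exact_mod_cast hceil

theorem exists_exponents_le_ceil_log_pow {ι : Type*} [Fintype ι] [Nonempty ι] {p : ι → ℕ}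
    (hp : ∀ i, 1 < p i) {n : ℕ} (hl : 1 ≤ Real.log (Real.log n))
    (hL : 4 * ∏ i, (p i : ℝ) ≤ Real.log n) :
    ∃ e : ι → ℕ, n ≤ ⌈Real.log n⌉₊ ^ (∏ i, p i ^ e i - 1) ∧
      (((∏ i, p i ^ e i - 1) * ⌈Real.log n⌉₊ : ℕ) : ℝ) ≤ Real.log n ^ 3 ∧
      ∀ i, (p i : ℝ) ^ e i ≤ p i * (2 * Real.log n / Real.log (Real.log n)) ^
        (Fintype.card ι : ℝ)⁻¹ := by
  have hl0 : 0 < Real.log (Real.log n) := by linarith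
  have hL1 := one_lt_log_of_log_log_pos hl0
  have hlL : Real.log (Real.log n) ≤ Real.log n := Real.log_le_self (by positivity)
  have hX : 1 ≤ 2 * Real.log n / Real.log (Real.log n) := by
    rw [one_le_div hl0]
    linarith
  obtain ⟨e, ⟨hXW, hWX⟩, he⟩ :=
    exists_prod_pow_mem_Icc (fun i => Nat.one_lt_cast (α := ℝ).2 (hp i)) hX
  refine ⟨e, le_ceil_log_pow hl0 (by exact_mod_cast hXW), ?_, he⟩
  have hX2 : 2 * Real.log n / Real.log (Real.log n) ≤ 2 * Real.log n :=
    div_le_self (by positivity) hl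
  have hceil : (⌈Real.log n⌉₊ : ℝ) ≤ 2 * Real.log n := by
    linarith [Nat.ceil_lt_add_one (zero_le_one.trans hL1.le)]
  calc (((∏ i, p i ^ e i - 1) * ⌈Real.log n⌉₊ : ℕ) : ℝ)
      ≤ ((∏ i, p i ^ e i) * ⌈Real.log n⌉₊ : ℕ) := by gcongr; exact Nat.sub_le _ _
    _ = (∏ i, (p i : ℝ) ^ e i) * ⌈Real.log n⌉₊ := by push_cast; rfl
    _ ≤ ((∏ i, (p i : ℝ)) * (2 * Real.log n)) * (2 * Real.log n) := by
      gcongr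
      exact hWX.trans (by gcongr)
    _ = (4 * ∏ i, (p i : ℝ)) * Real.log n ^ 2 := by ring
    _ ≤ Real.log n * Real.log n ^ 2 := by gcongr
    _ = Real.log n ^ 3 := by ring

theorem queryBits_le_exp {ι : Type*} [Fintype ι] {p e : ι → ℕ} {N : ℕ} {s t : ℝ} (hs : 0 ≤ s)
    (hN : N ≤ Real.exp s) (ht : ∀ i, (p i : ℝ) ^ e i ≤ t) :
    (queryBits p e N : ℝ) ≤ 2 * (∑ i, (p i : ℝ)) * Real.exp (t * s) := by
  have hterm (i : ι) : (N.choose (p i ^ e i - 1) + 1 : ℝ) ≤ 2 * Real.exp (t * s) := by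
    have hchoose : (N.choose (p i ^ e i - 1) : ℝ) ≤ Real.exp (t * s) := by
      calc (N.choose (p i ^ e i - 1) : ℝ) ≤ (N : ℝ) ^ (p i ^ e i - 1) := by
            exact_mod_cast Nat.choose_le_pow _ _
        _ ≤ Real.exp s ^ (p i ^ e i - 1) := by gcongr
        _ = Real.exp (((p i ^ e i - 1 : ℕ) : ℝ) * s) := (Real.exp_nat_mul _ _).symm
        _ ≤ Real.exp (t * s) := by
          gcongr
          refine le_trans ?_ (ht i)
          exact_mod_cast Nat.sub_le _ _
    have hone : 1 ≤ Real.exp (t * s) :=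
      Real.one_le_exp (mul_nonneg ((by positivity : (0 : ℝ) ≤ p i ^ e i).trans (ht i)) hs)
    linarith
  calc (queryBits p e N : ℝ) = ∑ i, (p i : ℝ) * (N.choose (p i ^ e i - 1) + 1) := by
        simp [queryBits]
    _ ≤ ∑ i, (p i : ℝ) * (2 * Real.exp (t * s)) := by gcongr with i; exact hterm i
    _ = 2 * (∑ i, (p i : ℝ)) * Real.exp (t * s) := by rw [← Finset.sum_mul]; ring

theorem two_mul_div_rpow_inv_mul_eq {r L l : ℝ} (hr : r ≠ 0) (hL : 0 < L) (hl : 0 < l) :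
    (2 * L / l) ^ r⁻¹ * l = 2 ^ r⁻¹ * (L * (l / L) ^ ((r - 1) / r)) := by
  have hexp : (r - 1) / r = 1 - r⁻¹ := by field_simp
  rw [mul_div_assoc, Real.mul_rpow (by norm_num) (by positivity), hexp,
    Real.rpow_sub (by positivity), Real.rpow_one, ← inv_div l L, Real.inv_rpow (by positivity)]
  field_simp

end Parameters

section Communication

variable {ι : Type} [Nonempty ι] {F : Type*} [Field F] [Finite F] {p : ι → ℕ} {γ : ι → F}
  {P : MvPolynomial ι F}

theorem nonempty_pirScheme [Finite ι] (hp : ∀ i, (p i).Prime)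
    (hinj : Function.Injective p) (hγ : ∀ i, IsPrimitiveRoot (γ i) (p i))
    (hP : IsDecodingPolynomial γ P) (n : ℕ) : Nonempty (PIRScheme #P.support n) := by
  have := Fintype.ofFinite ι
  have hprod : 1 < ∏ i, p i ^ 1 := by
    obtain ⟨i⟩ := ‹Nonempty ι›
    refine (hp i).one_lt.trans_le ?_
    rw [← pow_one (p i)]
    exact Finset.single_le_prod' (f := fun i => p i ^ 1)
      (fun i _ => Nat.one_le_pow _ _ (hp i).pos) (Finset.mem_univ i)
  obtain ⟨S, -⟩ := exists_pirScheme_of_le_pow hp hinj hγ hP (fun _ => 1) (n := n)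
    (Nat.le_self_pow (by omega) n)
  exact ⟨S⟩

variable [Fintype ι]

theorem exists_pirScheme_communication_le_exp (hp : ∀ i, (p i).Prime)
    (hinj : Function.Injective p) (hγ : ∀ i, IsPrimitiveRoot (γ i) (p i))
    (hP : IsDecodingPolynomial γ P) {n : ℕ} (hl : 1 ≤ Real.log (Real.log n))
    (hM : 4 * ∏ i, (p i : ℝ) ≤ Real.log n)
    (hK : #P.support * (2 * ∑ i, (p i : ℝ) + Nat.card F) ≤ Real.log n) :
    ∃ S : PIRScheme #P.support n, (S.communication : ℝ) ≤
      Real.exp ((3 * ∏ i, (p i : ℝ) + 1) *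
        ((2 * Real.log n / Real.log (Real.log n)) ^ (Fintype.card ι : ℝ)⁻¹ *
          Real.log (Real.log n))) := by
  set L := Real.log n
  set l := Real.log L
  set y := (2 * L / l) ^ (Fintype.card ι : ℝ)⁻¹
  set M := ∏ i, (p i : ℝ) with hMdef
  have hl0 : 0 < l := by linarith
  have hL1 : 1 < L := one_lt_log_of_log_log_pos hl0
  have hLexp : Real.exp l = L := Real.exp_log (by positivity)
  obtain ⟨e, hn, hN, he⟩ := exists_exponents_le_ceil_log_pow (fun i => (hp i).one_lt) hl hM
  obtain ⟨S, hS⟩ := exists_pirScheme_of_le_pow hp hinj hγ hP e hn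
  have hy : 1 ≤ y := by
    refine Real.one_le_rpow ?_ (by positivity)
    rw [one_le_div hl0]
    linarith [Real.log_le_self (zero_le_one.trans hL1.le)]
  have hpM (i : ι) : (p i : ℝ) ≤ M := by
    rw [hMdef, ← Nat.cast_prod, Nat.cast_le]
    exact Finset.single_le_prod' (fun i _ => (hp i).one_lt.le) (Finset.mem_univ i)
  have hquery : (queryBits p e ((∏ i, p i ^ e i - 1) * ⌈L⌉₊) : ℝ) ≤
      2 * (∑ i, (p i : ℝ)) * Real.exp (M * y * (3 * l)) := by
    refine queryBits_le_exp (by positivity) ?_ fun i => (he i).trans ?_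
    · rwa [show 3 * l = (3 : ℕ) * l by norm_num, Real.exp_nat_mul, hLexp]
    · have := hpM i
      gcongr
  refine ⟨S, ?_⟩
  have hanswer : (Nat.card F : ℝ) ≤ Nat.card F * Real.exp (M * y * (3 * l)) :=
    le_mul_of_one_le_right (by positivity) (Real.one_le_exp (by positivity))
  calc (S.communication : ℝ)
      = #P.support * (queryBits p e ((∏ i, p i ^ e i - 1) * ⌈L⌉₊) + Nat.card F) := by
        rw [hS]; push_cast; rfl
    _ ≤ #P.support * (2 * (∑ i, (p i : ℝ)) * Real.exp (M * y * (3 * l)) +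
          Nat.card F * Real.exp (M * y * (3 * l))) := by gcongr
    _ = #P.support * (2 * ∑ i, (p i : ℝ) + Nat.card F) * Real.exp (M * y * (3 * l)) := by ring
    _ ≤ Real.exp (y * l) * Real.exp (M * y * (3 * l)) := by
      gcongr
      calc _ ≤ L := hK
        _ = Real.exp l := hLexp.symm
        _ ≤ Real.exp (y * l) := by gcongr; exact le_mul_of_one_le_left hl0.le hy
    _ = Real.exp ((3 * M + 1) * (y * l)) := by rw [← Real.exp_add]; ring_nf

theorem exists_pirScheme_log_communication_isBigO (hp : ∀ i, (p i).Prime)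
    (hinj : Function.Injective p) (hγ : ∀ i, IsPrimitiveRoot (γ i) (p i))
    (hP : IsDecodingPolynomial γ P) :
    ∃ S : ∀ n, PIRScheme #P.support n,
      (fun n => Real.log (S n).communication) =O[atTop] fun n : ℕ => Real.log n *
        (Real.log (Real.log n) / Real.log n) ^ (((Fintype.card ι : ℝ) - 1) / Fintype.card ι) := by
  have hlog : Tendsto (fun n : ℕ => Real.log n) atTop atTop :=
    Real.tendsto_log_atTop.comp tendsto_natCast_atTop_atTop
  have (n : ℕ) : Nonempty (PIRScheme #P.support n) := nonempty_pirScheme hp hinj hγ hP n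
  suffices h : ∀ᶠ n : ℕ in atTop, ∃ S : PIRScheme #P.support n,
      ‖Real.log S.communication‖ ≤ (3 * ∏ i, (p i : ℝ) + 1) * 2 ^ (Fintype.card ι : ℝ)⁻¹ *
        ‖Real.log n * (Real.log (Real.log n) / Real.log n) ^
          (((Fintype.card ι : ℝ) - 1) / Fintype.card ι)‖ by
    obtain ⟨S, hS⟩ := skolem.1 h
    exact ⟨S, .of_bound _ hS⟩
  filter_upwards [(Real.tendsto_log_atTop.comp hlog).eventually_ge_atTop 1,
    hlog.eventually_ge_atTop _, hlog.eventually_ge_atTop _] with n hl hM hK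
  obtain ⟨S, hS⟩ := exists_pirScheme_communication_le_exp hp hinj hγ hP hl hM hK
  have hl0 : 0 < Real.log (Real.log n) := zero_lt_one.trans_le hl
  have hL1 := one_lt_log_of_log_log_pos hl0
  rw [two_mul_div_rpow_inv_mul_eq (by positivity) (by positivity) hl0, ← mul_assoc] at hS
  refine ⟨S, ?_⟩
  rw [Real.norm_of_nonneg (Real.log_natCast_nonneg _), Real.norm_of_nonneg (by positivity)]
  rcases S.communication.eq_zero_or_pos with h0 | hpos
  · rw [h0, Nat.cast_zero, Real.log_zero]
    positivity
  · exact (Real.log_le_iff_le_exp (Nat.cast_pos.2 hpos)).2 hS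

theorem exists_pirScheme_communication_le_rpow (hp : ∀ i, (p i).Prime)
    (hinj : Function.Injective p) (hγ : ∀ i, IsPrimitiveRoot (γ i) (p i))
    (hP : IsDecodingPolynomial γ P) :
    ∃ c : ℝ, 0 < c ∧ ∀ n : ℕ, ∃ S : PIRScheme #P.support n, 3 ≤ n →
      (S.communication : ℝ) ≤ (n : ℝ) ^ (c * (Real.log (Real.log n) / Real.log n) ^
        (((Fintype.card ι : ℝ) - 1) / Fintype.card ι)) := by
  obtain ⟨S, hS⟩ := exists_pirScheme_log_communication_isBigO hp hinj hγ hP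
  obtain ⟨c, hc, hbound⟩ := bound_of_isBigO_nat_atTop hS
  refine ⟨c, hc, fun n => ⟨S n, fun hn => ?_⟩⟩
  have hL : 1 < Real.log n := by
    rw [Real.lt_log_iff_exp_lt (by positivity)]
    exact Real.exp_one_lt_three.trans_le (by exact_mod_cast hn)
  have hrate : 0 < Real.log n * (Real.log (Real.log n) / Real.log n) ^
      (((Fintype.card ι : ℝ) - 1) / Fintype.card ι) := by
    have := Real.log_pos hL
    positivity
  have hn := hbound hrate.ne'
  rw [Real.norm_of_nonneg (Real.log_natCast_nonneg _), Real.norm_of_nonneg hrate.le] at hn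
  calc ((S n).communication : ℝ) ≤ Real.exp (Real.log (S n).communication) := Real.le_exp_log _
    _ ≤ _ := Real.exp_le_exp.2 hn
    _ = _ := by
      rw [Real.rpow_def_of_pos (Nat.cast_pos.2 (by omega)), mul_left_comm]

end Communication

section ThreeMonomials

universe u

/-- The polynomial `58 + 57 x y³ + 20 x² y`. It decodes the roots of unity `37` and `64` of orders
`3` and `11` in `𝔽₆₇` with three monomials, where a product of linear factors would have four. -/
noncomputable def trinomial : MvPolynomial (Fin 2) (ZMod 67) :=
  MvPolynomial.monomial 0 58 +
    MvPolynomial.monomial (Finsupp.single 0 1 + Finsupp.single 1 3) 57 +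
    MvPolynomial.monomial (Finsupp.single 0 2 + Finsupp.single 1 1) 20

theorem card_support_trinomial_le : #trinomial.support ≤ 3 :=
  (card_support_add_le _ _).trans <| Nat.add_le_add
    ((card_support_add_le _ _).trans <|
      Nat.add_le_add (card_support_monomial_le _ _) (card_support_monomial_le _ _))
    (card_support_monomial_le _ _)

theorem eval_trinomial (x : Fin 2 → ZMod 67) :
    trinomial.eval x = 58 + 57 * (x 0 * x 1 ^ 3) + 20 * (x 0 ^ 2 * x 1) := by
  simp [trinomial, MvPolynomial.eval_monomial, Finsupp.prod_add_index', pow_add]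

theorem isDecodingPolynomial_trinomial : IsDecodingPolynomial ![37, 64] trinomial where
  eval_one := by rw [eval_trinomial]; decide
  eval_eq_zero x hx hx1 := by
    have hx0 : x 0 = 1 ∨ x 0 = 37 := hx 0
    have hx1' : x 1 = 1 ∨ x 1 = 64 := hx 1
    have hne : ¬(x 0 = 1 ∧ x 1 = 1) := fun h => hx1 (funext (Fin.forall_fin_two.2 h))
    rw [eval_trinomial]
    rcases hx0 with h0 | h0 <;> rcases hx1' with h1 | h1 <;> rw [h0, h1] at hne ⊢
    · exact absurd ⟨rfl, rfl⟩ hne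
    all_goals decide

instance fact_prime_sixty_seven : Fact (Nat.Prime 67) := ⟨by norm_num⟩

theorem isPrimitiveRoot_thirtySeven_sixtyFour (i : Fin 2) :
    IsPrimitiveRoot (![37, 64] i : ZMod 67) (![3, 11] i) := by
  have : ∀ i : Fin 2, Fact (![3, 11] i).Prime :=
    Fin.forall_fin_two.2 ⟨⟨Nat.prime_three⟩, ⟨Nat.prime_eleven⟩⟩
  rw [IsPrimitiveRoot.iff_orderOf]
  exact orderOf_eq_prime (by revert i; decide) (by revert i; decide)

theorem exists_finite_field_isPrimitiveRoot (K : Type u) [Field K] [Finite K] {κ : Type*}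
    [Finite κ] (q : κ → ℕ) (hq : ∀ i, (q i : K) ≠ 0) :
    ∃ (F : Type u) (_ : Field F) (_ : Finite F) (_ : Algebra K F) (ζ : κ → F),
      ∀ i, IsPrimitiveRoot (ζ i) (q i) := by
  have := Fintype.ofFinite κ
  let m := ∏ i, q i
  have hm : (m : K) ≠ 0 := by
    rw [Nat.cast_prod]
    exact Finset.prod_ne_zero_iff.2 fun i _ => hq i
  have : NeZero (m : K) := ⟨hm⟩
  have : NeZero m := .of_neZero_natCast K
  have hζ := IsCyclotomicExtension.zeta_spec m K (CyclotomicField m K)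
  have : Module.Finite K (CyclotomicField m K) := IsCyclotomicExtension.finiteDimensional {m} K _
  refine ⟨CyclotomicField m K, inferInstance, Module.finite_of_finite K, inferInstance,
    fun i => IsCyclotomicExtension.zeta m K (CyclotomicField m K) ^ (m / q i), fun i => ?_⟩
  exact hζ.pow (NeZero.pos m)
    (Nat.div_mul_cancel (Finset.dvd_prod_of_mem q (Finset.mem_univ i))).symm

theorem exists_injective_primes_gt (N s : ℕ) :
    ∃ q : Fin s → ℕ, Function.Injective q ∧ ∀ i, (q i).Prime ∧ N < q i := by
  refine ⟨fun i => Nat.nth Nat.Prime (i + N), fun i j hij => ?_, fun i =>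
    ⟨Nat.prime_nth_prime _, ?_⟩⟩
  · exact Fin.ext (Nat.add_right_cancel (Nat.nth_injective Nat.infinite_setOfPred_prime hij))
  · change N < Nat.nth Nat.Prime (i + N)
    have := Nat.add_two_le_nth_prime (i + N)
    omega

theorem exists_isDecodingPolynomial_card_support_le {F κ : Type*} [Field F] [Algebra (ZMod 67) F]
    [Fintype κ] {ζ : κ → F} (hζ : ∀ i, ζ i ≠ 1) :
    ∃ P, IsDecodingPolynomial (Sum.elim (algebraMap (ZMod 67) F ∘ ![37, 64]) ζ) P ∧
      #P.support ≤ 3 * 2 ^ Fintype.card κ := by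
  refine ⟨_, (isDecodingPolynomial_trinomial.map _).rename_mul_rename
    (isDecodingPolynomial_prod hζ), (card_support_mul_le _ _).trans (Nat.mul_le_mul ?_ ?_)⟩
  · exact (card_support_rename_le Sum.inl_injective _).trans <|
      (Finset.card_le_card (MvPolynomial.support_map_subset _ _)).trans card_support_trinomial_le
  · calc _ ≤ _ := card_support_rename_le Sum.inr_injective _
      _ ≤ ∏ _i : κ, 2 := (card_support_prod_le _ _).trans <|
        Finset.prod_le_prod' fun i _ => card_support_C_mul_X_sub_C_le _ _ _
      _ = _ := by simp

theorem exists_primes_isDecodingPolynomial (s : ℕ) :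
    ∃ (p : Fin 2 ⊕ Fin s → ℕ) (F : Type) (_ : Field F) (_ : Finite F) (γ : Fin 2 ⊕ Fin s → F)
      (P : MvPolynomial (Fin 2 ⊕ Fin s) F), (∀ i, (p i).Prime) ∧ Function.Injective p ∧
      (∀ i, IsPrimitiveRoot (γ i) (p i)) ∧ IsDecodingPolynomial γ P ∧
      #P.support ≤ 3 * 2 ^ s := by
  obtain ⟨q, hqinj, hq⟩ := exists_injective_primes_gt 67 s
  have hq0 (i : Fin s) : (q i : ZMod 67) ≠ 0 := by
    rw [Ne, ZMod.natCast_eq_zero_iff, Nat.prime_dvd_prime_iff_eq Fact.out (hq i).1]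
    exact (hq i).2.ne
  obtain ⟨F, _, _, _, ζ, hζ⟩ := exists_finite_field_isPrimitiveRoot (ZMod 67) q hq0
  obtain ⟨P, hP, hcard⟩ :=
    exists_isDecodingPolynomial_card_support_le fun i => (hζ i).ne_one (hq i).1.one_lt
  refine ⟨Sum.elim ![3, 11] q, F, inferInstance, inferInstance, _, P, ?_, ?_, ?_, hP,
    by simpa using hcard⟩
  · exact Sum.rec (Fin.forall_fin_two.2 ⟨Nat.prime_three, Nat.prime_eleven⟩) fun i => (hq i).1
  · refine Function.Injective.sumElim (by decide) hqinj fun i j hij => ?_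
    have hsmall : ∀ i, (![3, 11] : Fin 2 → ℕ) i ≤ 67 := by decide
    exact ((hij ▸ hsmall i).trans_lt (hq j).2).false
  · exact Sum.rec (fun i => (isPrimitiveRoot_thirtySeven_sixtyFour i).map_of_injective
      (algebraMap (ZMod 67) F).injective) hζ

end ThreeMonomials

theorem mainTheorem4 (r : ℕ) (hr : 1 < r) :
    ∃ k : ℕ, k ≤ 3 * 2 ^ (r - 2) ∧
      ∃ c : ℝ, 0 < c ∧
        ∀ n : ℕ, 1 < n →
          ∃ P : PIRScheme k n,
            3 ≤ n →
              (P.communication : ℝ) ≤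
                (n : ℝ) ^ (c * (Real.log (Real.log (n : ℝ)) / Real.log (n : ℝ)) ^
                  (((r : ℝ) - 1) / (r : ℝ))) := by
  obtain ⟨s, rfl⟩ : ∃ s, r = 2 + s := Nat.exists_eq_add_of_le hr
  obtain ⟨p, F, _, _, γ, P, hp, hinj, hγ, hP, hcard⟩ := exists_primes_isDecodingPolynomial s
  obtain ⟨c, hc, hscheme⟩ := exists_pirScheme_communication_le_rpow hp hinj hγ hP
  have hι : Fintype.card (Fin 2 ⊕ Fin s) = 2 + s := by simp
  rw [hι] at hscheme
  exact ⟨#P.support, by rwa [Nat.add_sub_cancel_left], c, hc, fun n _ => hscheme n⟩
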